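/- **Setting.** For every index $k\in\mathbb N$ consider an asymmetric hub model with $n=n(k)$ nodes $\{1,\dots,n\}$, of which the first $n_L=n_L(k)<n$ form the (known) hub set, and $T=T(k)$ independent groups, where $n_L,n,T\to\infty$ as $k\to\infty$ (the index $k$ is suppressed below). The parameters are a probability vector $\rho=(\rho_1,\dots,\rho_{n_L})$ and a matrix $A\in[0,1]^{n_L\times n}$ with $A_{ii}=1$ for $i\le n_L$. Independently for each $t=1,\dots,T$, a hub $z_*^{(t)}$ is drawn with $\mathbb P(z_*^{(t)}=i)=\rho_i$, and given $z_*^{(t)}=i$ the indicators $G_j^{(t)}\in\{0,1\}$, $j=1,\dots,n$, are independent with $\mathbb P(G_j^{(t)}=1\mid z_*^{(t)}=i)=A_{ij}$. Only $G$ is observed. **Estimator.** For an assignment $z\in\{1,\dots,n_L\}^T$ put $$L_G(A|z)=\sum_{t=1}^T\sum_{j=1}^n\Big[G_j^{(t)}\log A_{z^{(t)},j}+(1-G_j^{(t)})\log(1-A_{z^{(t)},j})\Big]\qquad(\log 0=-\infty,\ 0\cdot(-\infty)=0),$$ and let $L_G(z)=\max_A L_G(A|z)$, the maximum being over all $A\in[0,1]^{n_L\times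 n}$ with $A_{ii}=1$ for $i\le n_L$. Let $\hat z=\hat z(G)$ be any maximizer of $L_G(z)$ over $z$. Let $$\hat A^{z}_{ij}=\frac{\sum_t G_j^{(t)}1(z^{(t)}=i)}{\sum_t 1(z^{(t)}=i)},$$ with $\hat A^z_{ij}=0$ if no group has label $i$. **Theorem.** Suppose there are constants $c_{\min},s_{\min},\tau_0,c_0>0$ and $c_{\max},s_{\max}\in\mathbb R$, not depending on $k$, and sequences $d=d(k)>0$, $v=v(k)>0$ such that - $H_1$: with probability tending to one, $Tc_{\min}/n_L\le \sum_t 1(z_*^{(t)}=i)\le Tc_{\max}/n_L$ for all $i=1,\dots,n_L$; - $H_2$: $A_{ij}=s_{ij}d$ with $s_{\min}\le s_{ij}\le s_{\max}$ for all $i\le n_L$, $j\le n$, $j\ne i$, and $d\to0$; - $H_3$: for every $i\le n_L$ there is a set $V_i\subset\{n_L+1,\dots,n\}$ with $|V_i|\ge vn/n_L$ and $s_{ij}-s_{i'j}\ge\tau_0$ for all $i'\le n_L$ with $i'\ne i$ and all $j\in V_i$; - $H_4$: $A_{ii'}\le c_0/n_L$ for all $i,i'\le n_L$ with $i\ne i'$.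 If, as $k\to\infty$, $$\frac{n_L\log n}{T}\to0,\qquad \frac{n_L^3\log T}{dTv}\to0,\qquad \frac{(\log d)^2n_L^4\log n_L}{dnv^2}\to0,\qquad \frac{(\log T)^2n_L^4\log n_L}{dnv^2}\to0,$$ then $$\max_{1\le i\le n_L,\ 1\le j\le n}\big|\hat A^{\hat z}_{ij}-A_{ij}\big|=o_p(1),$$ that is, for every $\varepsilon>0$ the probability that the maximum is at least $\varepsilon$ tends to $0$. -/

import Mathlib

open MeasureTheory Filter Topology

/-- The node of `Fin n` that is the `i`-th hub set member: the hub set consists of the first `nL`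
of the `n` nodes, and the remaining nodes are the followers. -/
def hubNode {nL n : ℕ} (h : nL < n) (i : Fin nL) : Fin n := Fin.castLE h.le i

/-- The parameter space for the matrix `A`: an `nL × n` matrix of probabilities such that every hub
appears in each group that it forms, `A i i = 1`. -/
def hubMatrices {nL n : ℕ} (h : nL < n) : Set (Matrix (Fin nL) (Fin n) ℝ) :=
  {A | (∀ i j, 0 ≤ A i j ∧ A i j ≤ 1) ∧ ∀ i, A i (hubNode h i) = 1}

/-- The parameters `(ρ, A)` of an asymmetric hub model with `n` nodes, of which the first `nL < n`
form the hub set. -/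
structure HubModel (nL n : ℕ) where
  lt : nL < n
  ρ : Fin nL → ℝ
  ρ_nonneg : ∀ i, 0 ≤ ρ i
  ρ_sum : ∑ i, ρ i = 1
  A : Matrix (Fin nL) (Fin n) ℝ
  A_mem : A ∈ hubMatrices lt

/-- The Bernoulli distribution with success probability `a`. -/
noncomputable def bernoulliLaw (a : ℝ) : Measure Bool :=
  ENNReal.ofReal a • Measure.dirac true + ENNReal.ofReal (1 - a) • Measure.dirac false

/-- The joint law of the hub and of one group: the hub `i` has probability `ρ i`, and given the hub
`i` the nodes `j` appear independently with probabilities `A i j`. -/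
noncomputable def HubModel.groupLaw {nL n : ℕ} (M : HubModel nL n) :
    Measure (Fin nL × (Fin n → Bool)) :=
  ∑ i, ENNReal.ofReal (M.ρ i) •
    (Measure.dirac i).prod (Measure.pi fun j => bernoulliLaw (M.A i j))

/-- The law of `T` independent groups together with their hubs. -/
noncomputable def HubModel.law {nL n : ℕ} (M : HubModel nL n) (T : ℕ) :
    Measure (Fin T → Fin nL × (Fin n → Bool)) :=
  Measure.pi fun _ => M.groupLaw

/-- The true hub labels of a sample. -/
def trueLabels {nL n T : ℕ} (ω : Fin T → Fin nL × (Fin n → Bool)) : Fin T → Fin nL :=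
  fun t => (ω t).1

/-- The observed data of a sample: `groups ω t j` says whether node `j` appears in group `t`. -/
def groups {nL n T : ℕ} (ω : Fin T → Fin nL × (Fin n → Bool)) : Fin T → Fin n → Bool :=
  fun t => (ω t).2

/-- The number of groups that the assignment `z` labels with the hub `i`. -/
def labelCount {nL T : ℕ} (z : Fin T → Fin nL) (i : Fin nL) : ℕ :=
  (Finset.univ.filter fun t => z t = i).card

/-- The plug-in estimator of `A i j` under the assignment `z`: the proportion of groups with label
`i` that contain node `j`. It is `0` if no group has label `i` (a division by zero here). -/
noncomputable def plugIn {nL n T : ℕ} (G : Fin T → Fin n → Bool) (z : Fin T → Fin nL)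
    (i : Fin nL) (j : Fin n) : ℝ :=
  ((Finset.univ.filter fun t => z t = i ∧ G t j = true).card : ℝ) / (labelCount z i : ℝ)

/-- The logarithm of a nonnegative real, with `log 0 = -∞`. -/
noncomputable def elog (a : ℝ) : EReal := ENNReal.log (ENNReal.ofReal a)

/-- The log-likelihood of the data `G` given the assignment `z`,
`∑ t, ∑ j, G t j * log (A (z t) j) + (1 - G t j) * log (1 - A (z t) j)`, where `log 0 = -∞` and
`0 * (-∞) = 0`. -/
noncomputable def logLik {nL n T : ℕ} (G : Fin T → Fin n → Bool)
    (A : Matrix (Fin nL) (Fin n) ℝ) (z : Fin T → Fin nL) : EReal :=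
  ∑ t, ∑ j, if G t j = true then elog (A (z t) j) else elog (1 - A (z t) j)

/-- The profile log-likelihood of the assignment `z`: the maximum of the log-likelihood over all
matrices of the parameter space. It is `-∞` if some group does not contain the hub that `z`
assigns to it. -/
noncomputable def profileLogLik {nL n T : ℕ} (h : nL < n) (G : Fin T → Fin n → Bool)
    (z : Fin T → Fin nL) : EReal :=
  ⨆ A ∈ hubMatrices h, logLik G A z

/-- `zhat` maximizes the profile log-likelihood of every data set. -/
def IsMaxProfileLik {nL n T : ℕ} (h : nL < n)
    (zhat : (Fin T → Fin n → Bool) → (Fin T → Fin nL)) : Prop :=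
  ∀ (G : Fin T → Fin n → Bool) (z : Fin T → Fin nL),
    profileLogLik h G z ≤ profileLogLik h G (zhat G)

/-- The maximal error of the plug-in estimator over all entries of `A`. -/
noncomputable def maxError {nL n T : ℕ} (A : Matrix (Fin nL) (Fin n) ℝ)
    (G : Fin T → Fin n → Bool) (z : Fin T → Fin nL) : ℝ :=
  ⨆ p : Fin nL × Fin n, |plugIn G z p.1 p.2 - A p.1 p.2|

/-- The probability of `b` under the Bernoulli distribution with success probability `a`. -/
noncomputable def bernoulliWeight (a : ℝ) (b : Bool) : ℝ := if b = true then a else 1 - a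

/-- The probability of the pair of a hub and a group. -/
noncomputable def groupWeight {nL n : ℕ} (M : HubModel nL n) (x : Fin nL × (Fin n → Bool)) : ℝ :=
  M.ρ x.1 * ∏ j, bernoulliWeight (M.A x.1 j) (x.2 j)

lemma bernoulliWeight_nonneg {a : ℝ} (h0 : 0 ≤ a) (h1 : a ≤ 1) (b : Bool) :
    0 ≤ bernoulliWeight a b := by
  unfold bernoulliWeight; split_ifs <;> linarith

lemma sum_bernoulliWeight_mul (a : ℝ) (f : Bool → ℝ) :
    ∑ b, bernoulliWeight a b * f b = a * f true + (1 - a) * f false := by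
  simp [bernoulliWeight]

instance bernoulliLaw_isFinite (a : ℝ) : IsFiniteMeasure (bernoulliLaw a) :=
  ⟨by simp [bernoulliLaw]⟩

lemma bernoulliLaw_singleton (a : ℝ) (b : Bool) :
    bernoulliLaw a {b} = ENNReal.ofReal (bernoulliWeight a b) := by
  cases b <;> simp [bernoulliLaw, bernoulliWeight]

section
variable {nL n T : ℕ} (M : HubModel nL n)

lemma HubModel.A_nonneg (i : Fin nL) (j : Fin n) : 0 ≤ M.A i j := (M.A_mem.1 i j).1

lemma HubModel.A_le_one (i : Fin nL) (j : Fin n) : M.A i j ≤ 1 := (M.A_mem.1 i j).2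

lemma prod_bernoulliWeight_nonneg (i : Fin nL) (G : Fin n → Bool) :
    0 ≤ ∏ j, bernoulliWeight (M.A i j) (G j) :=
  Finset.prod_nonneg fun j _ => bernoulliWeight_nonneg (M.A_nonneg i j) (M.A_le_one i j) _

lemma groupWeight_nonneg (x : Fin nL × (Fin n → Bool)) : 0 ≤ groupWeight M x :=
  mul_nonneg (M.ρ_nonneg _) (prod_bernoulliWeight_nonneg M _ _)

lemma sum_prod_bernoulliWeight_mul (a : Fin n → ℝ) (f : Fin n → Bool → ℝ) :
    ∑ G : Fin n → Bool, (∏ j, bernoulliWeight (a j) (G j)) * ∏ j, f j (G j) =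
      ∏ j, (a j * f j true + (1 - a j) * f j false) := by
  simp_rw [← sum_bernoulliWeight_mul, Fintype.prod_sum, Finset.prod_mul_distrib]

lemma sum_prod_bernoulliWeight (a : Fin n → ℝ) :
    ∑ G : Fin n → Bool, ∏ j, bernoulliWeight (a j) (G j) = 1 := by
  have h := sum_prod_bernoulliWeight_mul a (fun _ _ => 1)
  simpa using h

lemma sum_groupWeight : ∑ x, groupWeight M x = 1 := by
  rw [Fintype.sum_prod_type]
  simp only [groupWeight, ← Finset.mul_sum, sum_prod_bernoulliWeight, mul_one, M.ρ_sum]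

instance groupLaw_isFinite : IsFiniteMeasure M.groupLaw := by
  refine ⟨?_⟩
  simp only [HubModel.groupLaw, Measure.coe_finsetSum, Finset.sum_apply, Measure.smul_apply,
    smul_eq_mul]
  exact ENNReal.sum_lt_top.2 fun i _ => ENNReal.mul_lt_top ENNReal.ofReal_lt_top
    (measure_lt_top _ _)

lemma groupLaw_singleton (x : Fin nL × (Fin n → Bool)) :
    M.groupLaw {x} = ENNReal.ofReal (groupWeight M x) := by
  obtain ⟨i, G⟩ := x
  simp only [HubModel.groupLaw, Measure.coe_finsetSum, Finset.sum_apply, Measure.smul_apply,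
    smul_eq_mul]
  rw [Finset.sum_eq_single i]
  · rw [← Set.singleton_prod_singleton, Measure.prod_prod, Measure.pi_singleton]
    simp only [bernoulliLaw_singleton, groupWeight]
    rw [ENNReal.ofReal_mul (M.ρ_nonneg i), ENNReal.ofReal_prod_of_nonneg
      fun j _ => bernoulliWeight_nonneg (M.A_nonneg i j) (M.A_le_one i j) _]
    simp
  · intro i' _ hi
    rw [← Set.singleton_prod_singleton, Measure.prod_prod]
    simp [hi]
  · simp

instance law_isFinite : IsFiniteMeasure (M.law T) := by
  unfold HubModel.law; infer_instance

lemma law_real_eq (S : Set (Fin T → Fin nL × (Fin n → Bool))) [DecidablePred (· ∈ S)] :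
    (M.law T).real S = ∑ ω with ω ∈ S, ∏ t, groupWeight M (ω t) := by
  have h : ∀ ω : Fin T → Fin nL × (Fin n → Bool),
      (M.law T).real {ω} = ∏ t, groupWeight M (ω t) := by
    intro ω
    rw [Measure.real, HubModel.law, Measure.pi_singleton]
    simp only [groupLaw_singleton]
    rw [ENNReal.toReal_prod]
    exact Finset.prod_congr rfl fun t _ => ENNReal.toReal_ofReal (groupWeight_nonneg M _)
  simp_rw [← h]
  rw [sum_measureReal_singleton]
  simp

lemma law_real_univ : (M.law T).real Set.univ = 1 := by
  classical
  rw [law_real_eq]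
  simp only [Set.mem_univ, Finset.filter_true]
  rw [← Fintype.prod_sum (fun _ : Fin T => groupWeight M)]
  simp [sum_groupWeight]

instance law_isProbability : IsProbabilityMeasure (M.law T) := by
  refine ⟨?_⟩
  have h := law_real_univ (T := T) M
  rw [Measure.real] at h
  exact (ENNReal.toReal_eq_one_iff _).1 h

/-- An exponential Markov inequality for product weights: if the weight of every sample in `S` is
at most `K` times a product of nonnegative functions with sums at most one, then `S` has
probability at most `K`. -/
lemma law_real_le {S : Set (Fin T → Fin nL × (Fin n → Bool))} {K : ℝ} (hK : 0 ≤ K)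
    (f : Fin T → Fin nL × (Fin n → Bool) → ℝ) (hf : ∀ t x, 0 ≤ f t x)
    (hS : ∀ ω ∈ S, ∏ t, groupWeight M (ω t) ≤ K * ∏ t, f t (ω t))
    (hsum : ∀ t, ∑ x, f t x ≤ 1) : (M.law T).real S ≤ K := by
  classical
  rw [law_real_eq]
  calc ∑ ω with ω ∈ S, ∏ t, groupWeight M (ω t)
      ≤ ∑ ω with ω ∈ S, K * ∏ t, f t (ω t) :=
        Finset.sum_le_sum fun ω hω => hS ω (Finset.mem_filter.1 hω).2
    _ ≤ ∑ ω : Fin T → Fin nL × (Fin n → Bool), K * ∏ t, f t (ω t) := by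
        rw [Finset.sum_filter]
        refine Finset.sum_le_sum fun ω _ => ?_
        split_ifs
        · exact le_rfl
        · exact mul_nonneg hK (Finset.prod_nonneg fun t _ => hf t _)
    _ = K * ∏ t, ∑ x, f t x := by rw [← Finset.mul_sum, ← Fintype.prod_sum f]
    _ ≤ K * 1 := mul_le_mul_of_nonneg_left
        (Finset.prod_le_one (fun t _ => Finset.sum_nonneg fun x _ => hf t x) fun t _ => hsum t) hK
    _ = K := mul_one K

end

section
variable {nL n T : ℕ}

/-- The likelihood of the data `G` given the assignment `z`. -/
noncomputable def lik (G : Fin T → Fin n → Bool) (A : Matrix (Fin nL) (Fin n) ℝ)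
    (z : Fin T → Fin nL) : ℝ :=
  ∏ t, ∏ j, bernoulliWeight (A (z t) j) (G t j)

lemma lik_nonneg {G : Fin T → Fin n → Bool} {A : Matrix (Fin nL) (Fin n) ℝ} {z : Fin T → Fin nL}
    (hA : ∀ i j, 0 ≤ A i j ∧ A i j ≤ 1) : 0 ≤ lik G A z :=
  Finset.prod_nonneg fun _ _ => Finset.prod_nonneg fun _ _ =>
    bernoulliWeight_nonneg (hA _ _).1 (hA _ _).2 _

lemma ENNReal.log_prod {ι : Type*} (s : Finset ι) (f : ι → ENNReal) :
    ENNReal.log (∏ i ∈ s, f i) = ∑ i ∈ s, ENNReal.log (f i) := by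
  classical
  induction s using Finset.induction_on with
  | empty => simp
  | insert a s ha ih => rw [Finset.prod_insert ha, Finset.sum_insert ha, ENNReal.log_mul_add, ih]

lemma logLik_eq {G : Fin T → Fin n → Bool} {A : Matrix (Fin nL) (Fin n) ℝ} {z : Fin T → Fin nL}
    (hA : ∀ i j, 0 ≤ A i j ∧ A i j ≤ 1) :
    logLik G A z = ENNReal.log (ENNReal.ofReal (lik G A z)) := by
  have hw : ∀ t j, 0 ≤ bernoulliWeight (A (z t) j) (G t j) := fun _ _ =>
    bernoulliWeight_nonneg (hA _ _).1 (hA _ _).2 _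
  rw [lik, ENNReal.ofReal_prod_of_nonneg fun t _ => Finset.prod_nonneg fun j _ => hw t j,
    ENNReal.log_prod, logLik]
  refine Finset.sum_congr rfl fun t _ => ?_
  rw [ENNReal.ofReal_prod_of_nonneg fun j _ => hw t j, ENNReal.log_prod]
  refine Finset.sum_congr rfl fun j _ => ?_
  unfold elog bernoulliWeight
  split_ifs <;> rfl

lemma logLik_le_iff {G : Fin T → Fin n → Bool} {A B : Matrix (Fin nL) (Fin n) ℝ}
    {z w : Fin T → Fin nL} (hA : ∀ i j, 0 ≤ A i j ∧ A i j ≤ 1) (hB : ∀ i j, 0 ≤ B i j ∧ B i j ≤ 1) :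
    logLik G A z ≤ logLik G B w ↔ lik G A z ≤ lik G B w := by
  rw [logLik_eq hA, logLik_eq hB, ENNReal.log_le_log_iff,
    ENNReal.ofReal_le_ofReal_iff (lik_nonneg hB)]

/-- The binomial likelihood is maximal at the observed frequency. -/
lemma pow_mul_one_sub_pow_le {a : ℝ} (h0 : 0 ≤ a) (h1 : a ≤ 1) (m k : ℕ) {p : ℝ}
    (hp : p * ((m + k : ℕ) : ℝ) = m) (hpos : 0 < m + k) :
    a ^ m * (1 - a) ^ k ≤ p ^ m * (1 - p) ^ k := by
  have hN : (0 : ℝ) < ((m + k : ℕ) : ℝ) := by exact_mod_cast hpos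
  have hpe : p = m / ((m + k : ℕ) : ℝ) := by rw [eq_div_iff hN.ne', hp]
  have hp0 : 0 ≤ p := by rw [hpe]; positivity
  have hq : (1 - p) * ((m + k : ℕ) : ℝ) = k := by
    rw [sub_mul, hp]; push_cast; ring
  have hq0 : 0 ≤ 1 - p := by
    have : (1 - p) = k / ((m + k : ℕ) : ℝ) := by rw [eq_div_iff hN.ne', hq]
    rw [this]; positivity
  have key : ∀ (x r : ℝ) (l : ℕ), 0 ≤ x → 0 ≤ r → r * ((m + k : ℕ) : ℝ) = l →
      x ^ l ≤ r ^ l * Real.exp (((m + k : ℕ) : ℝ) * (x - r)) := by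
    intro x r l hx hr hl
    rcases Nat.eq_zero_or_pos l with rfl | hlpos
    · have hr0 : r = 0 := by
        rcases mul_eq_zero.1 (hl.trans Nat.cast_zero) with h | h
        · exact h
        · exact absurd h hN.ne'
      simp only [pow_zero, hr0, sub_zero, one_mul]
      exact Real.one_le_exp (by positivity)
    · have hlr : (0 : ℝ) < l := by exact_mod_cast hlpos
      have hr' : 0 < r := by
        rcases hr.lt_or_eq with h | h
        · exact h
        · rw [← h, zero_mul] at hl; linarith
      have hexp : x / r ≤ Real.exp (x / r - 1) := by
        have := Real.add_one_le_exp (x / r - 1); linarith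
      have h2 : (x / r) ^ l ≤ Real.exp (x / r - 1) ^ l :=
        pow_le_pow_left₀ (by positivity) hexp l
      rw [← Real.exp_nat_mul, ← hl] at h2
      have h3 : r * ((m + k : ℕ) : ℝ) * (x / r - 1) = ((m + k : ℕ) : ℝ) * (x - r) := by
        field_simp
      rw [h3] at h2
      calc x ^ l = r ^ l * (x / r) ^ l := by rw [← mul_pow, mul_div_cancel₀ _ hr'.ne']
        _ ≤ _ := mul_le_mul_of_nonneg_left h2 (by positivity)
  have e1 := key a p m h0 hp0 hp
  have e2 := key (1 - a) (1 - p) k (by linarith) hq0 hq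
  calc a ^ m * (1 - a) ^ k
      ≤ (p ^ m * Real.exp (((m + k : ℕ) : ℝ) * (a - p))) *
        ((1 - p) ^ k * Real.exp (((m + k : ℕ) : ℝ) * (1 - a - (1 - p)))) :=
        mul_le_mul e1 e2 (pow_nonneg (by linarith) _) (by positivity)
    _ = p ^ m * (1 - p) ^ k * (Real.exp (((m + k : ℕ) : ℝ) * (a - p)) *
        Real.exp (((m + k : ℕ) : ℝ) * (1 - a - (1 - p)))) := by ring
    _ = p ^ m * (1 - p) ^ k := by
        rw [← Real.exp_add]; ring_nf; simp

/-- The number of groups with label `i` that contain `j`. -/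
def memberCount (G : Fin T → Fin n → Bool) (z : Fin T → Fin nL) (i : Fin nL) (j : Fin n) : ℕ :=
  (Finset.univ.filter fun t => z t = i ∧ G t j = true).card

lemma plugIn_eq (G : Fin T → Fin n → Bool) (z : Fin T → Fin nL) (i : Fin nL) (j : Fin n) :
    plugIn G z i j = (memberCount G z i j : ℝ) / labelCount z i := rfl

lemma memberCount_le (G : Fin T → Fin n → Bool) (z : Fin T → Fin nL) (i : Fin nL) (j : Fin n) :
    memberCount G z i j ≤ labelCount z i :=
  Finset.card_le_card fun t ht => by simp at ht ⊢; exact ht.1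

lemma labelCount_le (z : Fin T → Fin nL) (i : Fin nL) : labelCount z i ≤ T :=
  (Finset.card_le_univ _).trans_eq (Fintype.card_fin T)

lemma plugIn_mem (G : Fin T → Fin n → Bool) (z : Fin T → Fin nL) (i : Fin nL) (j : Fin n) :
    0 ≤ plugIn G z i j ∧ plugIn G z i j ≤ 1 := by
  rw [plugIn_eq]
  exact ⟨by positivity, div_le_one_of_le₀ (by exact_mod_cast memberCount_le G z i j)
    (by positivity)⟩

lemma lik_eq_prod_pow (G : Fin T → Fin n → Bool) (A : Matrix (Fin nL) (Fin n) ℝ)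
    (z : Fin T → Fin nL) : lik G A z =
      ∏ i, ∏ j, (A i j ^ memberCount G z i j *
        (1 - A i j) ^ (Finset.univ.filter fun t => z t = i ∧ ¬ G t j = true).card) := by
  unfold lik
  rw [← Finset.prod_fiberwise (s := Finset.univ) (g := z)]
  refine Finset.prod_congr rfl fun i _ => ?_
  rw [Finset.prod_comm]
  refine Finset.prod_congr rfl fun j _ => ?_
  have : ∀ t ∈ Finset.univ.filter (fun t => z t = i), bernoulliWeight (A (z t) j) (G t j) =
      if G t j = true then A i j else 1 - A i j := by
    intro t ht
    rw [(Finset.mem_filter.1 ht).2]; rfl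
  rw [Finset.prod_congr rfl this, Finset.prod_ite, Finset.prod_const, Finset.prod_const,
    Finset.filter_filter, Finset.filter_filter, memberCount]

/-- The plug-in estimator maximizes the likelihood for a given assignment. -/
lemma lik_le_lik_plugIn (G : Fin T → Fin n → Bool) {A : Matrix (Fin nL) (Fin n) ℝ}
    (z : Fin T → Fin nL) (hA : ∀ i j, 0 ≤ A i j ∧ A i j ≤ 1) :
    lik G A z ≤ lik G (plugIn G z) z := by
  rw [lik_eq_prod_pow G A z, lik_eq_prod_pow G (plugIn G z) z]
  have h0 : ∀ i j, 0 ≤ A i j ^ memberCount G z i j *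
        (1 - A i j) ^ (Finset.univ.filter fun t => z t = i ∧ ¬ G t j = true).card := fun i j =>
    mul_nonneg (pow_nonneg (hA i j).1 _) (pow_nonneg (by linarith [(hA i j).2]) _)
  refine Finset.prod_le_prod (fun i _ => Finset.prod_nonneg fun j _ => h0 i j) fun i _ =>
    Finset.prod_le_prod (fun j _ => h0 i j) fun j _ => ?_
  have hc : memberCount G z i j + (Finset.univ.filter fun t => z t = i ∧ ¬ G t j = true).card =
      labelCount z i := by
    rw [labelCount, ← Finset.card_filter_add_card_filter_not
      (s := Finset.univ.filter fun t => z t = i) (fun t => G t j = true),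
      Finset.filter_filter, Finset.filter_filter, memberCount]
  rcases Nat.eq_zero_or_pos (labelCount z i) with h | h
  · rw [h] at hc
    obtain ⟨h1, h2⟩ := Nat.add_eq_zero_iff.1 hc
    rw [h1, h2]; simp
  · refine pow_mul_one_sub_pow_le (hA i j).1 (hA i j).2 _ _ ?_ (by omega)
    rw [hc, plugIn_eq, div_mul_cancel₀]
    exact_mod_cast h.ne'

lemma lik_le_lik_estimate {h : nL < n} {zhat : (Fin T → Fin n → Bool) → (Fin T → Fin nL)}
    (hz : IsMaxProfileLik h zhat) {A : Matrix (Fin nL) (Fin n) ℝ} (hA : A ∈ hubMatrices h)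
    (G : Fin T → Fin n → Bool) (z : Fin T → Fin nL) :
    lik G A z ≤ lik G (plugIn G (zhat G)) (zhat G) := by
  rw [← logLik_le_iff hA.1 (plugIn_mem G _)]
  calc logLik G A z ≤ profileLogLik h G z := le_iSup₂_of_le A hA le_rfl
    _ ≤ profileLogLik h G (zhat G) := hz G z
    _ ≤ _ := iSup₂_le fun B hB =>
      (logLik_le_iff hB.1 (plugIn_mem G _)).2 (lik_le_lik_plugIn G _ hB.1)

lemma mem_of_lik_pos {h : nL < n} {A : Matrix (Fin nL) (Fin n) ℝ} (hA : A ∈ hubMatrices h)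
    {G : Fin T → Fin n → Bool} {z : Fin T → Fin nL} (hpos : 0 < lik G A z) (t : Fin T) :
    G t (hubNode h (z t)) = true := by
  by_contra hG
  refine hpos.ne' (Finset.prod_eq_zero (Finset.mem_univ t)
    (Finset.prod_eq_zero (Finset.mem_univ (hubNode h (z t))) ?_))
  simp [bernoulliWeight, hG, hA.2]

/-- If the true parameters give the data a positive likelihood, then every group contains the hub
that the estimator assigns to it. -/
lemma mem_of_estimate {h : nL < n} {zhat : (Fin T → Fin n → Bool) → (Fin T → Fin nL)}
    (hz : IsMaxProfileLik h zhat) {A : Matrix (Fin nL) (Fin n) ℝ} (hA : A ∈ hubMatrices h)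
    {G : Fin T → Fin n → Bool} {z : Fin T → Fin nL} (hpos : 0 < lik G A z) (t : Fin T) :
    G t (hubNode h (zhat G t)) = true := by
  have h1 : ⊥ < profileLogLik h G (zhat G) := by
    refine lt_of_lt_of_le ?_ ((le_iSup₂_of_le A hA le_rfl : logLik G A z ≤
      profileLogLik h G z).trans (hz G z))
    rw [logLik_eq hA.1, ENNReal.bot_lt_log_iff]
    exact ENNReal.ofReal_pos.2 hpos
  obtain ⟨B, hB⟩ := lt_iSup_iff.1 h1
  obtain ⟨hB, hlt⟩ := lt_iSup_iff.1 hB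
  rw [logLik_eq hB.1, ENNReal.bot_lt_log_iff, ENNReal.ofReal_pos] at hlt
  exact mem_of_lik_pos hB hlt t

end

lemma sqrt_mul_add_sqrt_mul_le {p q : ℝ} (hp : 0 ≤ p ∧ p ≤ 1) (hq : 0 ≤ q ∧ q ≤ 1) :
    √(p * q) + √((1 - p) * (1 - q)) ≤ Real.exp (-((√p - √q) ^ 2 / 2)) := by
  have hp' : 0 ≤ 1 - p := by linarith [hp.2]
  have hq' : 0 ≤ 1 - q := by linarith [hq.2]
  rw [Real.sqrt_mul hp.1, Real.sqrt_mul hp']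
  have h1 := Real.sq_sqrt hp.1
  have h2 := Real.sq_sqrt hq.1
  have h3 := Real.sq_sqrt hp'
  have h4 := Real.sq_sqrt hq'
  have h5 := Real.add_one_le_exp (-((√p - √q) ^ 2 / 2))
  nlinarith [sq_nonneg (√(1 - p) - √(1 - q))]

section
variable {nL n T : ℕ}

/-- The Hellinger loss of describing the groups of the hub `a` in the row `A a` by the row `B i`. -/
noncomputable def hellingerLoss (A B : Matrix (Fin nL) (Fin n) ℝ) (a i : Fin nL) : ℝ :=
  ∑ j, (√(A a j) - √(B i j)) ^ 2 / 2

lemma sum_prod_sqrt_bernoulliWeight_le {A B : Matrix (Fin nL) (Fin n) ℝ}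
    (hA : ∀ i j, 0 ≤ A i j ∧ A i j ≤ 1) (hB : ∀ i j, 0 ≤ B i j ∧ B i j ≤ 1) (a i : Fin nL) :
    ∑ G : Fin n → Bool, ∏ j, √(bernoulliWeight (A a j) (G j) * bernoulliWeight (B i j) (G j)) ≤
      Real.exp (-hellingerLoss A B a i) := by
  rw [← Fintype.prod_sum (fun j b => √(bernoulliWeight (A a j) b * bernoulliWeight (B i j) b)),
    hellingerLoss, ← Finset.sum_neg_distrib, Real.exp_sum]
  refine Finset.prod_le_prod (fun j _ => Finset.sum_nonneg fun _ _ => Real.sqrt_nonneg _)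
    fun j _ => ?_
  simpa [bernoulliWeight] using sqrt_mul_add_sqrt_mul_le (hA a j) (hB i j)

lemma prod_groupWeight (M : HubModel nL n) (ω : Fin T → Fin nL × (Fin n → Bool)) :
    ∏ t, groupWeight M (ω t) = (∏ t, M.ρ (ω t).1) * lik (groups ω) M.A (trueLabels ω) := by
  simp only [groupWeight, Finset.prod_mul_distrib]; rfl

/-- For a fixed assignment and a fixed matrix, it is unlikely that they have a larger likelihood
than the truth while many groups have a large Hellinger loss. -/
lemma law_real_lik_le_lik (M : HubModel nL n) (z : Fin T → Fin nL)
    {B : Matrix (Fin nL) (Fin n) ℝ} (hB : ∀ i j, 0 ≤ B i j ∧ B i j ≤ 1) {g : ℝ} (hg : 0 ≤ g)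
    (m : ℝ) :
    (M.law T).real {ω | lik (groups ω) M.A (trueLabels ω) ≤ lik (groups ω) B z ∧
      m ≤ ((Finset.univ.filter fun t =>
        g ≤ hellingerLoss M.A B (trueLabels ω t) (z t)).card : ℝ)} ≤ Real.exp (-(g * m)) := by
  have hA := M.A_mem.1
  refine law_real_le M (Real.exp_pos _).le
    (fun t x => M.ρ x.1 *
      (∏ j, √(bernoulliWeight (M.A x.1 j) (x.2 j) * bernoulliWeight (B (z t) j) (x.2 j))) *
      Real.exp (if g ≤ hellingerLoss M.A B x.1 (z t) then g else 0)) ?_ ?_ ?_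
  · intro t x
    exact mul_nonneg (mul_nonneg (M.ρ_nonneg _) (Finset.prod_nonneg fun _ _ => Real.sqrt_nonneg _))
      (Real.exp_pos _).le
  · rintro ω ⟨hlik, hm⟩
    have hwA : ∀ i j b, 0 ≤ bernoulliWeight (M.A i j) b := fun i j b =>
      bernoulliWeight_nonneg (hA i j).1 (hA i j).2 b
    have hwB : ∀ i j b, 0 ≤ bernoulliWeight (B i j) b := fun i j b =>
      bernoulliWeight_nonneg (hB i j).1 (hB i j).2 b
    set h : ℝ := ∏ t, ∏ j, √(bernoulliWeight (M.A (ω t).1 j) ((ω t).2 j) *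
      bernoulliWeight (B (z t) j) ((ω t).2 j)) with hh
    have h0 : 0 ≤ h :=
      Finset.prod_nonneg fun _ _ => Finset.prod_nonneg fun _ _ => Real.sqrt_nonneg _
    have hsq : h ^ 2 = lik (groups ω) M.A (trueLabels ω) * lik (groups ω) B z := by
      simp only [hh, lik, ← Finset.prod_pow, ← Finset.prod_mul_distrib]
      exact Finset.prod_congr rfl fun t _ => Finset.prod_congr rfl fun j _ =>
        Real.sq_sqrt (mul_nonneg (hwA _ _ _) (hwB _ _ _))
    have hle : lik (groups ω) M.A (trueLabels ω) ≤ h := by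
      rw [← pow_le_pow_iff_left₀ (lik_nonneg hA) h0 two_ne_zero, hsq, sq]
      exact mul_le_mul_of_nonneg_left hlik (lik_nonneg hA)
    have hexp : 1 ≤ Real.exp (-(g * m)) * ∏ t, Real.exp
        (if g ≤ hellingerLoss M.A B (ω t).1 (z t) then g else 0) := by
      rw [← Real.exp_sum, ← Real.exp_add, ← Finset.sum_filter, Finset.sum_const, nsmul_eq_mul]
      apply Real.one_le_exp
      have hm' : m ≤ ((Finset.univ.filter fun t =>
        g ≤ hellingerLoss M.A B (ω t).1 (z t)).card : ℝ) := hm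
      linarith [mul_le_mul_of_nonneg_left hm' hg]
    have hρ : 0 ≤ ∏ t, M.ρ (ω t).1 := Finset.prod_nonneg fun _ _ => M.ρ_nonneg _
    rw [prod_groupWeight, Finset.prod_mul_distrib, Finset.prod_mul_distrib]
    calc (∏ t, M.ρ (ω t).1) * lik (groups ω) M.A (trueLabels ω)
        ≤ (∏ t, M.ρ (ω t).1) * h := mul_le_mul_of_nonneg_left hle hρ
      _ ≤ ((∏ t, M.ρ (ω t).1) * h) * (Real.exp (-(g * m)) * ∏ t, Real.exp
        (if g ≤ hellingerLoss M.A B (ω t).1 (z t) then g else 0)) :=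
          le_mul_of_one_le_right (mul_nonneg hρ h0) hexp
      _ = _ := by ring
  · intro t
    rw [Fintype.sum_prod_type]
    refine (Finset.sum_le_sum fun i _ => ?_).trans_eq M.ρ_sum
    have hfac : (∑ G : Fin n → Bool, M.ρ i *
        (∏ j, √(bernoulliWeight (M.A i j) (G j) * bernoulliWeight (B (z t) j) (G j))) *
        Real.exp (if g ≤ hellingerLoss M.A B i (z t) then g else 0)) = M.ρ i *
        ((∑ G : Fin n → Bool,
          ∏ j, √(bernoulliWeight (M.A i j) (G j) * bernoulliWeight (B (z t) j) (G j))) *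
        Real.exp (if g ≤ hellingerLoss M.A B i (z t) then g else 0)) := by
      rw [Finset.sum_mul, Finset.mul_sum]
      exact Finset.sum_congr rfl fun _ _ => mul_assoc _ _ _
    refine hfac.trans_le (mul_le_of_le_one_right (M.ρ_nonneg i) ?_)
    calc _ ≤ Real.exp (-hellingerLoss M.A B i (z t)) *
          Real.exp (if g ≤ hellingerLoss M.A B i (z t) then g else 0) :=
          mul_le_mul_of_nonneg_right (sum_prod_sqrt_bernoulliWeight_le hA hB _ _)
            (Real.exp_pos _).le
      _ ≤ 1 := by
          rw [← Real.exp_add, Real.exp_le_one_iff]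
          split_ifs with hc
          · linarith
          · have : 0 ≤ hellingerLoss M.A B i (z t) :=
              Finset.sum_nonneg fun _ _ => by positivity
            linarith

lemma sum_prod_bernoulliWeight_mul_exp_le {p : Fin n → ℝ} (j : Fin n) (hp : 0 ≤ p j) :
    ∑ G : Fin n → Bool, (∏ l, bernoulliWeight (p l) (G l)) *
      Real.exp ((if G j = true then 1 else 0) - 2 * p j) ≤ 1 := by
  have h : ∀ G : Fin n → Bool, (∏ l, bernoulliWeight (p l) (G l)) *
      Real.exp ((if G j = true then 1 else 0) - 2 * p j) =
      Real.exp (-(2 * p j)) * ((∏ l, bernoulliWeight (p l) (G l)) *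
        ∏ l, (if l = j ∧ G l = true then Real.exp 1 else 1)) := by
    intro G
    rw [Finset.prod_eq_single (f := fun l => if l = j ∧ G l = true then Real.exp 1 else 1) j
      (fun l _ hl => by simp [hl]) (by simp), sub_eq_add_neg, Real.exp_add]
    by_cases hG : G j = true
    · simp only [hG, if_true, and_self]; ring
    · simp only [hG, if_false, and_false, Real.exp_zero, Bool.false_eq_true]; ring
  simp only [h, ← Finset.mul_sum]
  rw [sum_prod_bernoulliWeight_mul p (fun l b => if l = j ∧ b = true then Real.exp 1 else 1),
    Finset.prod_eq_single j (fun l _ hl => by simp [hl]) (by simp)]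
  simp only [and_self, if_true, Bool.false_eq_true, and_false, if_false, mul_one]
  have he : p j * Real.exp 1 + (1 - p j) ≤ Real.exp (2 * p j) := by
    have h1 := Real.add_one_le_exp (2 * p j)
    have h2 := Real.exp_one_lt_d9
    nlinarith
  calc _ ≤ Real.exp (-(2 * p j)) * Real.exp (2 * p j) :=
        mul_le_mul_of_nonneg_left he (Real.exp_pos _).le
    _ = 1 := by rw [← Real.exp_add]; simp

/-- An upper tail bound for the number of groups of the hub `i` that contain `j`. -/
lemma law_real_memberCount_le (M : HubModel nL n) (i : Fin nL) (j : Fin n) (x y : ℝ) :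
    (M.law T).real {ω | x ≤ (memberCount (groups ω) (trueLabels ω) i j : ℝ) ∧
      (labelCount (trueLabels ω) i : ℝ) ≤ y} ≤ Real.exp (-(x - 2 * M.A i j * y)) := by
  have hA := M.A_mem.1
  refine law_real_le M (Real.exp_pos _).le
    (fun t p => groupWeight M p * Real.exp ((if p.1 = i ∧ p.2 j = true then 1 else 0) -
      2 * M.A i j * if p.1 = i then 1 else 0)) ?_ ?_ ?_
  · exact fun t p => mul_nonneg (groupWeight_nonneg M p) (Real.exp_pos _).le
  · rintro ω ⟨hx, hy⟩
    rw [Finset.prod_mul_distrib, ← Real.exp_sum, Finset.sum_sub_distrib, ← Finset.mul_sum,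
      Finset.sum_boole, Finset.sum_boole, mul_left_comm, ← Real.exp_add]
    refine le_mul_of_one_le_right (Finset.prod_nonneg fun t _ => groupWeight_nonneg M _)
      (Real.one_le_exp ?_)
    have hx' : x ≤ ((Finset.univ.filter fun t => (ω t).1 = i ∧ (ω t).2 j = true).card : ℝ) := hx
    have hy' : ((Finset.univ.filter fun t => (ω t).1 = i).card : ℝ) ≤ y := hy
    linarith [mul_le_mul_of_nonneg_left hy' (mul_nonneg zero_le_two (hA i j).1)]
  · intro t
    rw [Fintype.sum_prod_type]
    refine (Finset.sum_le_sum fun a _ => ?_).trans_eq M.ρ_sum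
    simp only [groupWeight, mul_assoc, ← Finset.mul_sum]
    refine mul_le_of_le_one_right (M.ρ_nonneg a) ?_
    rcases eq_or_ne a i with rfl | ha
    · simpa using sum_prod_bernoulliWeight_mul_exp_le (p := M.A a) j (hA a j).1
    · simp [ha, sum_prod_bernoulliWeight]

/-- If every label is cheap for at most one true hub, two different hubs are rarely confused and
all hubs are frequent, then the wrong labels are among the few labels that are not cheap. -/
lemma card_ne_le_of_cheap {I : Type*} [Fintype I] [DecidableEq I] {w z : Fin T → I}
    {cheap : I → I → Prop} [DecidableRel cheap]
    (huniq : ∀ a b i, cheap a i → cheap b i → a = b) {x y m : ℝ}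
    (hconf : ∀ a i, a ≠ i → ((Finset.univ.filter fun t => w t = a ∧ z t = i).card : ℝ) ≤ x)
    (hfreq : ∀ i, y ≤ ((Finset.univ.filter fun t => w t = i).card : ℝ))
    (hm : ((Finset.univ.filter fun t => ¬ cheap (w t) (z t)).card : ℝ) ≤ m) (hxy : m + x < y) :
    ((Finset.univ.filter fun t => z t ≠ w t).card : ℝ) ≤ m := by
  have hm0 : 0 ≤ m := le_trans (by positivity) hm
  refine le_trans ?_ hm
  rw [Nat.cast_le]
  refine Finset.card_le_card fun t₀ ht₀ => ?_
  simp only [Finset.mem_filter, Finset.mem_univ, true_and] at ht₀ ⊢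
  intro hcheap
  let D : Finset I := Finset.univ.filter fun i => ∃ a, a ≠ i ∧ cheap a i
  have hD : z t₀ ∈ D := by simpa [D] using ⟨w t₀, fun h => ht₀ h.symm, hcheap⟩
  have hsub : (Finset.univ.filter fun t => w t ∈ D) ⊆
      (Finset.univ.filter fun t => ¬ cheap (w t) (z t)) ∪
        D.biUnion fun i => Finset.univ.filter fun t => z t = i ∧ cheap (w t) i ∧ w t ≠ i := by
    intro t ht
    simp only [D, Finset.mem_filter, Finset.mem_univ, true_and, Finset.mem_union,
      Finset.mem_biUnion] at ht ⊢
    by_cases hc : cheap (w t) (z t)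
    · right
      have hne : w t ≠ z t := by
        obtain ⟨a, ha, hca⟩ := ht
        intro h
        rw [← h] at hc
        exact ha (huniq _ _ _ hca hc)
      exact ⟨z t, ⟨w t, hne, hc⟩, rfl, hc, hne⟩
    · exact Or.inl hc
  have hcell : ∀ i ∈ D, ((Finset.univ.filter fun t =>
      z t = i ∧ cheap (w t) i ∧ w t ≠ i).card : ℝ) ≤ x := by
    intro i hi
    obtain ⟨a, ha, hca⟩ := (Finset.mem_filter.1 hi).2
    refine le_trans ?_ (hconf a i ha)
    rw [Nat.cast_le]
    refine Finset.card_le_card fun t ht => ?_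
    simp only [Finset.mem_filter, Finset.mem_univ, true_and] at ht ⊢
    exact ⟨huniq _ _ _ ht.2.1 hca, ht.1⟩
  have hlow : (D.card : ℝ) * y ≤ ((Finset.univ.filter fun t => w t ∈ D).card : ℝ) := by
    rw [Finset.card_eq_sum_card_fiberwise (f := w) (t := D) (fun t ht => by simpa using ht),
      Nat.cast_sum, ← nsmul_eq_mul]
    refine Finset.card_nsmul_le_sum _ _ _ fun i hi => (hfreq i).trans ?_
    rw [Nat.cast_le]
    refine Finset.card_le_card fun t ht => ?_
    simp only [Finset.mem_filter, Finset.mem_univ, true_and] at ht ⊢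
    exact ⟨ht ▸ hi, ht⟩
  have hup : ((Finset.univ.filter fun t => w t ∈ D).card : ℝ) ≤ m + D.card * x := by
    have h1 := (Finset.card_le_card hsub).trans
      ((Finset.card_union_le _ _).trans (Nat.add_le_add_left Finset.card_biUnion_le _))
    have h2 : ((Finset.univ.filter fun t => w t ∈ D).card : ℝ) ≤ _ := Nat.cast_le.2 h1
    rw [Nat.cast_add, Nat.cast_sum] at h2
    have h3 := Finset.sum_le_card_nsmul D _ x hcell
    rw [nsmul_eq_mul] at h3
    linarith
  have hD1 : (1 : ℝ) ≤ D.card := by exact_mod_cast Finset.card_pos.2 ⟨_, hD⟩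
  nlinarith

end

section
variable {nL n T : ℕ}

lemma sq_sqrt_sub_sqrt_ge {s s' d τ smax : ℝ} (hd : 0 < d) (hτ : 0 < τ) (hs' : 0 ≤ s')
    (hss : τ ≤ s - s') (hs : s ≤ smax) :
    τ ^ 2 * d / (4 * smax) ≤ (√(s * d) - √(s' * d)) ^ 2 := by
  have hsmax : 0 < smax := by linarith
  have h1 := Real.sq_sqrt (mul_nonneg (by linarith : 0 ≤ s) hd.le)
  have h2 := Real.sq_sqrt (mul_nonneg hs' hd.le)
  rw [div_le_iff₀ (by positivity)]
  set p := √(s * d)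
  set q := √(s' * d)
  have h3 : (p + q) ^ 2 ≤ 4 * smax * d := by nlinarith [sq_nonneg (p - q)]
  have h4 : τ ^ 2 * d ^ 2 ≤ (p - q) ^ 2 * (p + q) ^ 2 := by
    have : (p - q) ^ 2 * (p + q) ^ 2 = ((s - s') * d) ^ 2 := by
      rw [← mul_pow]; congr 1; linear_combination h1 - h2
    rw [this, ← mul_pow]
    exact pow_le_pow_left₀ (by positivity) (mul_le_mul_of_nonneg_right hss hd.le) 2
  have h5 := mul_le_mul_of_nonneg_left h3 (sq_nonneg (p - q))
  refine le_of_mul_le_mul_right ?_ hd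
  nlinarith

/-- Two rows of `A` that are separated on a set of followers cannot both be close to the same row. -/
lemma hellingerLoss_add_ge {A B s : Matrix (Fin nL) (Fin n) ℝ} {a b : Fin nL} (i : Fin nL)
    {V : Finset (Fin n)} {d τ smax : ℝ} (hd : 0 < d) (hτ : 0 < τ)
    (ha : ∀ j ∈ V, A a j = s a j * d ∧ s a j ≤ smax) (hb : ∀ j ∈ V, A b j = s b j * d ∧ 0 ≤ s b j)
    (hsep : ∀ j ∈ V, τ ≤ s a j - s b j) :
    (V.card : ℝ) * (τ ^ 2 * d / (16 * smax)) ≤ hellingerLoss A B a i + hellingerLoss A B b i := by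
  rw [hellingerLoss, hellingerLoss, ← Finset.sum_add_distrib]
  calc (V.card : ℝ) * (τ ^ 2 * d / (16 * smax))
      ≤ ∑ j ∈ V, ((√(A a j) - √(B i j)) ^ 2 / 2 + (√(A b j) - √(B i j)) ^ 2 / 2) := by
        rw [← nsmul_eq_mul]
        refine Finset.card_nsmul_le_sum _ _ _ fun j hj => ?_
        have h := sq_sqrt_sub_sqrt_ge hd hτ (hb j hj).2 (hsep j hj) (ha j hj).2
        rw [← (ha j hj).1, ← (hb j hj).1] at h
        have h16 : τ ^ 2 * d / (16 * smax) = τ ^ 2 * d / (4 * smax) / 4 := by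
          rw [div_div]; congr 1; ring
        rw [h16]
        nlinarith [sq_nonneg (√(A a j) + √(A b j) - 2 * √(B i j))]
    _ ≤ _ := Finset.sum_le_sum_of_subset_of_nonneg (Finset.subset_univ V)
        fun j _ _ => by positivity

lemma maxError_lt {A : Matrix (Fin nL) (Fin n) ℝ} {G : Fin T → Fin n → Bool}
    {z : Fin T → Fin nL} {ε : ℝ} (hε : 0 < ε) (h : ∀ i j, |plugIn G z i j - A i j| < ε) :
    maxError A G z < ε := by
  unfold maxError
  rcases isEmpty_or_nonempty (Fin nL × Fin n) with he | he
  · rwa [Real.iSup_of_isEmpty]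
  · obtain ⟨p, hp⟩ := exists_eq_ciSup_of_finite
      (f := fun p : Fin nL × Fin n => |plugIn G z p.1 p.2 - A p.1 p.2|)
    rw [← hp]
    exact h _ _

lemma memberCount_le_add (G : Fin T → Fin n → Bool) (w z : Fin T → Fin nL) (i : Fin nL)
    (j : Fin n) : memberCount G z i j ≤
      memberCount G w i j + (Finset.univ.filter fun t => z t ≠ w t).card := by
  refine (Finset.card_le_card fun t ht => ?_).trans (Finset.card_union_le _ _)
  simp only [Finset.mem_filter, Finset.mem_univ, true_and, Finset.mem_union] at ht ⊢
  by_cases h : z t = w t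
  · exact Or.inl ⟨h ▸ ht.1, ht.2⟩
  · exact Or.inr h

lemma labelCount_le_add (w z : Fin T → Fin nL) (i : Fin nL) : labelCount w i ≤
      labelCount z i + (Finset.univ.filter fun t => z t ≠ w t).card := by
  refine (Finset.card_le_card fun t ht => ?_).trans (Finset.card_union_le _ _)
  simp only [Finset.mem_filter, Finset.mem_univ, true_and, Finset.mem_union] at ht ⊢
  by_cases h : z t = w t
  · exact Or.inl (h ▸ ht)
  · exact Or.inr h

/-- The plug-in estimator is accurate for an assignment `z` with few errors. -/
lemma abs_plugIn_sub_lt {h : nL < n} {A : Matrix (Fin nL) (Fin n) ℝ} (hA : A ∈ hubMatrices h)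
    {G : Fin T → Fin n → Bool} {w z : Fin T → Fin nL} (hmem : ∀ t, G t (hubNode h (z t)) = true)
    {x y m α ε : ℝ} (hfreq : ∀ i, y ≤ (labelCount w i : ℝ))
    (hX : ∀ i j, j ≠ hubNode h i → (memberCount G w i j : ℝ) ≤ x)
    (herr : ((Finset.univ.filter fun t => z t ≠ w t).card : ℝ) ≤ m) (hmy : m < y)
    (hα : ∀ i j, j ≠ hubNode h i → A i j ≤ α) (hαε : α < ε) (hxm : x + m < ε * (y - m))
    (hε : 0 < ε) (i : Fin nL) (j : Fin n) : |plugIn G z i j - A i j| < ε := by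
  have hpos : y - m ≤ (labelCount z i : ℝ) := by
    have h1 : (labelCount w i : ℝ) ≤ _ := Nat.cast_le.2 (labelCount_le_add w z i)
    rw [Nat.cast_add] at h1
    linarith [hfreq i]
  have hpos' : 0 < (labelCount z i : ℝ) := by linarith
  by_cases hj : j = hubNode h i
  · have hm : memberCount G z i j = labelCount z i := by
      refine congrArg Finset.card (Finset.filter_congr fun t _ => ?_)
      refine ⟨fun h => h.1, fun ht => ⟨ht, ?_⟩⟩
      rw [hj, ← ht]; exact hmem t
    rw [plugIn_eq, hm, div_self hpos'.ne', hj, hA.2]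
    simpa using hε
  · have h1 : (memberCount G z i j : ℝ) ≤ _ := Nat.cast_le.2 (memberCount_le_add G w z i j)
    rw [Nat.cast_add] at h1
    have h2 : plugIn G z i j < ε := by
      rw [plugIn_eq, div_lt_iff₀ hpos']
      have := mul_le_mul_of_nonneg_left hpos hε.le
      linarith [hX i j hj]
    rw [abs_lt]
    have := (plugIn_mem G z i j).1
    have := (hA.1 i j).1
    have := hα i j hj
    constructor <;> linarith

/-- The matrix with the entries `c i j / labelCount z i`, the form of the plug-in estimator. -/
noncomputable def countMatrix (z : Fin T → Fin nL) (c : Fin nL → Fin n → Fin (T + 1)) :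
    Matrix (Fin nL) (Fin n) ℝ :=
  fun i j => ((c i j : ℕ) : ℝ) / labelCount z i

lemma law_real_lik_eq_zero (M : HubModel nL n) :
    (M.law T).real {ω | lik (groups ω) M.A (trueLabels ω) = 0} = 0 := by
  refine le_antisymm (law_real_le M le_rfl (fun _ _ => 0) (fun _ _ => le_rfl) ?_ (by simp))
    measureReal_nonneg
  intro ω hω
  rw [prod_groupWeight, show lik (groups ω) M.A (trueLabels ω) = 0 from hω]
  simp

/-- It is unlikely that some assignment, together with its plug-in estimator, has a larger
likelihood than the truth while many groups have a large Hellinger loss. -/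
lemma law_real_exists_lik_le_lik (M : HubModel nL n) {g : ℝ} (hg : 0 ≤ g) (m : ℝ) :
    (M.law T).real {ω | ∃ z : Fin T → Fin nL,
      lik (groups ω) M.A (trueLabels ω) ≤ lik (groups ω) (plugIn (groups ω) z) z ∧
      m ≤ ((Finset.univ.filter fun t =>
        g ≤ hellingerLoss M.A (plugIn (groups ω) z) (trueLabels ω t) (z t)).card : ℝ)} ≤
      (nL : ℝ) ^ T * ((T : ℝ) + 1) ^ (nL * n) * Real.exp (-(g * m)) := by
  let S : (Fin T → Fin nL) × (Fin nL → Fin n → Fin (T + 1)) →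
      Set (Fin T → Fin nL × (Fin n → Bool)) := fun p =>
    {ω | (∀ i j, 0 ≤ countMatrix p.1 p.2 i j ∧ countMatrix p.1 p.2 i j ≤ 1) ∧
      lik (groups ω) M.A (trueLabels ω) ≤ lik (groups ω) (countMatrix p.1 p.2) p.1 ∧
      m ≤ ((Finset.univ.filter fun t =>
        g ≤ hellingerLoss M.A (countMatrix p.1 p.2) (trueLabels ω t) (p.1 t)).card : ℝ)}
  have hS : ∀ p, (M.law T).real (S p) ≤ Real.exp (-(g * m)) := by
    intro p
    by_cases hB : ∀ i j, 0 ≤ countMatrix p.1 p.2 i j ∧ countMatrix p.1 p.2 i j ≤ 1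
    · exact (measureReal_mono fun ω hω => hω.2).trans (law_real_lik_le_lik M p.1 hB hg m)
    · have : S p = ∅ := Set.eq_empty_of_forall_notMem fun ω hω => hB hω.1
      rw [this, measureReal_empty]
      exact (Real.exp_pos _).le
  calc _ ≤ (M.law T).real (⋃ p, S p) := by
        refine measureReal_mono ?_
        rintro ω ⟨z, hz⟩
        exact Set.mem_iUnion.2 ⟨(z, fun i j => ⟨memberCount (groups ω) z i j,
          Nat.lt_succ_of_le ((memberCount_le _ z i j).trans (labelCount_le z i))⟩),
          plugIn_mem (groups ω) z, hz⟩
    _ ≤ ∑ p, (M.law T).real (S p) := measureReal_iUnion_fintype_le S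
    _ ≤ ∑ _p : (Fin T → Fin nL) × (Fin nL → Fin n → Fin (T + 1)), Real.exp (-(g * m)) :=
        Finset.sum_le_sum fun p _ => hS p
    _ = _ := by
        rw [Finset.sum_const, nsmul_eq_mul]
        congr 1
        simp [Fintype.card_prod, Fintype.card_pi, pow_mul, mul_comm nL n]

lemma law_real_exists_memberCount_le (M : HubModel nL n) {x y α : ℝ} (hy : 0 ≤ y)
    (hα : ∀ i j, j ≠ hubNode M.lt i → M.A i j ≤ α) :
    (M.law T).real {ω | ∃ i j, j ≠ hubNode M.lt i ∧
      x ≤ (memberCount (groups ω) (trueLabels ω) i j : ℝ) ∧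
      (labelCount (trueLabels ω) i : ℝ) ≤ y} ≤ (nL : ℝ) * n * Real.exp (-(x - 2 * α * y)) := by
  let S : Fin nL × Fin n → Set (Fin T → Fin nL × (Fin n → Bool)) := fun p =>
    {ω | p.2 ≠ hubNode M.lt p.1 ∧ x ≤ (memberCount (groups ω) (trueLabels ω) p.1 p.2 : ℝ) ∧
      (labelCount (trueLabels ω) p.1 : ℝ) ≤ y}
  have hS : ∀ p, (M.law T).real (S p) ≤ Real.exp (-(x - 2 * α * y)) := by
    intro p
    by_cases hp : p.2 ≠ hubNode M.lt p.1
    · refine ((measureReal_mono fun ω hω => hω.2).trans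
        (law_real_memberCount_le M p.1 p.2 x y)).trans (Real.exp_le_exp.2 ?_)
      have := mul_le_mul_of_nonneg_right (hα p.1 p.2 hp) hy
      linarith
    · have : S p = ∅ := Set.eq_empty_of_forall_notMem fun ω hω => hp hω.1
      rw [this, measureReal_empty]
      exact (Real.exp_pos _).le
  calc _ ≤ (M.law T).real (⋃ p, S p) := by
        refine measureReal_mono ?_
        rintro ω ⟨i, j, hij⟩
        exact Set.mem_iUnion.2 ⟨(i, j), hij⟩
    _ ≤ ∑ p, (M.law T).real (S p) := measureReal_iUnion_fintype_le S
    _ ≤ ∑ _p : Fin nL × Fin n, Real.exp (-(x - 2 * α * y)) := Finset.sum_le_sum fun p _ => hS p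
    _ = _ := by rw [Finset.sum_const, nsmul_eq_mul]; simp

/-- A bound for finite samples on the error probability of the plug-in estimator under the maximum
profile likelihood assignment. -/
lemma law_real_maxError_le (M : HubModel nL n)
    {zhat : (Fin T → Fin n → Bool) → (Fin T → Fin nL)} (hz : IsMaxProfileLik M.lt zhat)
    {g m x y y' α ε : ℝ} (hg : 0 ≤ g) (hy' : 0 ≤ y')
    (hsep : ∀ (B : Matrix (Fin nL) (Fin n) ℝ) (a b i : Fin nL), a ≠ b →
      2 * g ≤ hellingerLoss M.A B a i + hellingerLoss M.A B b i)
    (hα : ∀ i j, j ≠ hubNode M.lt i → M.A i j ≤ α) (hx : 0 ≤ x) (hxy : m + x < y)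
    (hαε : α < ε) (hxm : x + m < ε * (y - m)) (hε : 0 < ε) :
    (M.law T).real {ω | ε ≤ maxError M.A (groups ω) (zhat (groups ω))} ≤
      (M.law T).real {ω | ∀ i, y ≤ (labelCount (trueLabels ω) i : ℝ) ∧
        (labelCount (trueLabels ω) i : ℝ) ≤ y'}ᶜ +
      (nL : ℝ) * n * Real.exp (-(x - 2 * α * y')) +
      (nL : ℝ) ^ T * ((T : ℝ) + 1) ^ (nL * n) * Real.exp (-(g * m)) := by
  refine le_trans ?_ (add_le_add (add_le_add le_rfl
    (law_real_exists_memberCount_le (T := T) M hy' hα)) (law_real_exists_lik_le_lik M hg m))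
  rw [← add_zero (_ + _ + _), ← law_real_lik_eq_zero (T := T) M]
  refine le_trans (measureReal_mono ?_) ((measureReal_union_le _ _).trans (add_le_add_left
    ((measureReal_union_le _ _).trans (add_le_add_left (measureReal_union_le _ _) _)) _))
  intro ω hω
  by_contra hcon
  simp only [Set.mem_union, not_or, Set.mem_compl_iff, not_not, Set.mem_ofPred_eq] at hcon
  obtain ⟨⟨⟨hfreq, hX⟩, hL⟩, hpos⟩ := hcon
  have hlik : 0 < lik (groups ω) M.A (trueLabels ω) :=
    lt_of_le_of_ne (lik_nonneg M.A_mem.1) (Ne.symm hpos)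
  have hmem := mem_of_estimate hz M.A_mem hlik
  set z := zhat (groups ω) with hzdef
  have hX' : ∀ i j, j ≠ hubNode M.lt i →
      (memberCount (groups ω) (trueLabels ω) i j : ℝ) ≤ x := by
    intro i j hij
    by_contra hlt
    exact hX ⟨i, j, hij, (not_le.1 hlt).le, (hfreq i).2⟩
  have hnoncheap : ((Finset.univ.filter fun t => ¬ hellingerLoss M.A (plugIn (groups ω) z)
      (trueLabels ω t) (z t) < g).card : ℝ) ≤ m := by
    simp only [not_lt]
    by_contra hlt
    exact hL ⟨z, lik_le_lik_estimate hz M.A_mem _ _, (not_le.1 hlt).le⟩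
  have herr := card_ne_le_of_cheap (w := trueLabels ω) (z := z) (x := x) (y := y) (m := m)
    (cheap := fun a i => hellingerLoss M.A (plugIn (groups ω) z) a i < g) ?_ ?_
    (fun i => (hfreq i).1) hnoncheap hxy
  · refine not_le.2 (maxError_lt hε ?_) hω
    exact abs_plugIn_sub_lt M.A_mem hmem (fun i => (hfreq i).1) hX' herr (by linarith) hα hαε
      hxm hε
  · intro a b i ha hb
    by_contra hab
    have := hsep (plugIn (groups ω) z) a b i hab
    linarith
  · intro a i hai
    have hne : hubNode M.lt i ≠ hubNode M.lt a := fun h =>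
      hai (Fin.castLE_injective M.lt.le h).symm
    refine le_trans ?_ (hX' a _ hne)
    rw [Nat.cast_le]
    refine Finset.card_le_card fun t ht => ?_
    simp only [Finset.mem_filter, Finset.mem_univ, true_and] at ht ⊢
    exact ⟨ht.1, ht.2 ▸ hmem t⟩

end

/-- The bound for the number of entries with many groups: the union bound over the entries is
dominated if the groups per hub outnumber the logarithm of the number of nodes. -/
lemma entries_bound {nL n T η a : ℝ} (hnL : 0 < nL) (hnLn : nL ≤ n)
    (hrate : nL * Real.log n / T ≤ η / 8) (hT : 0 < T) (ha : a ≤ η / 2 * (T / nL)) :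
    nL * n * Real.exp (-(η * (T / nL) - a)) ≤ Real.exp (-(2 * Real.log n)) := by
  have hn : 0 < n := hnL.trans_le hnLn
  have h1 : 8 * Real.log n ≤ η * (T / nL) := by
    rw [div_le_iff₀ hT] at hrate
    rw [← mul_div_assoc, le_div_iff₀ hnL]
    nlinarith
  have h2 : nL * n ≤ Real.exp (2 * Real.log n) := by
    rw [two_mul, Real.exp_add, Real.exp_log hn]
    exact mul_le_mul_of_nonneg_right hnLn hn.le
  calc nL * n * Real.exp (-(η * (T / nL) - a))
      ≤ Real.exp (2 * Real.log n) * Real.exp (-(η * (T / nL) - a)) :=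
        mul_le_mul_of_nonneg_right h2 (Real.exp_pos _).le
    _ ≤ _ := by
        rw [← Real.exp_add, Real.exp_le_exp]
        linarith

/-- The union bound over the assignments and their plug-in estimators is dominated by the
separation of the hubs. -/
lemma assignments_bound {nL n T : ℕ} {d v κ η : ℝ} (hd : 0 < d) (hv : 0 < v) (hκ : 0 < κ)
    (hη : 0 < η) (hnL : 1 ≤ Real.log nL) (hn : 0 < n) (hT : 1 ≤ Real.log T) (hvn : v ≤ nL)
    (hrate₂ : (nL : ℝ) ^ 3 * Real.log T / (d * T * v) ≤ κ * η / 8)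
    (hrate₄ : Real.log T ^ 2 * (nL : ℝ) ^ 4 * Real.log nL / (d * n * v ^ 2) ≤ κ * η / 4) :
    (nL : ℝ) ^ T * ((T : ℝ) + 1) ^ (nL * n) *
      Real.exp (-(v * n / nL * (κ * d) * (η * (T / nL)))) ≤ Real.exp (-T) := by
  have hnL0 : (0 : ℝ) < nL := by
    rcases (Nat.cast_nonneg (α := ℝ) nL).lt_or_eq with h | h
    · exact h
    · rw [← h, Real.log_zero] at hnL; linarith
  have hT0 : (0 : ℝ) < T := by
    rcases (Nat.cast_nonneg (α := ℝ) T).lt_or_eq with h | h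
    · exact h
    · rw [← h, Real.log_zero] at hT; linarith
  have hn0 : (0 : ℝ) < n := by exact_mod_cast hn
  have hnL1 : (1 : ℝ) ≤ nL := by
    have : 0 < nL := by exact_mod_cast hnL0
    exact_mod_cast this
  have hT2 : (2 : ℝ) ≤ T := by
    have := Real.log_le_sub_one_of_pos hT0
    linarith
  set W : ℝ := κ * η * (v * n * d * T / (nL : ℝ) ^ 2) with hW
  have hWe : v * n / nL * (κ * d) * (η * (T / nL)) = W := by
    rw [hW]; field_simp
  have hlogT : Real.log ((T : ℝ) + 1) ≤ 2 * Real.log T := by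
    rw [← Real.log_rpow hT0]
    refine Real.log_le_log (by linarith) ?_
    rw [Real.rpow_two]
    nlinarith
  have h1 : (nL : ℝ) * n * Real.log (T + 1) ≤ W / 4 := by
    rw [div_le_iff₀ (by positivity)] at hrate₂
    have h2 : (nL : ℝ) * n * Real.log (T + 1) ≤ nL * n * (2 * Real.log T) :=
      mul_le_mul_of_nonneg_left hlogT (by positivity)
    refine h2.trans ?_
    have h3 : W / 4 = 2 * n / (nL : ℝ) ^ 2 * (κ * η / 8 * (d * T * v)) := by
      rw [hW]; field_simp; ring
    have h4 : (nL : ℝ) * n * (2 * Real.log T) =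
        2 * n / (nL : ℝ) ^ 2 * ((nL : ℝ) ^ 3 * Real.log T) := by field_simp
    rw [h3, h4]
    exact mul_le_mul_of_nonneg_left hrate₂ (by positivity)
  have h2 : (T : ℝ) * Real.log nL ≤ W / 4 := by
    rw [div_le_iff₀ (by positivity)] at hrate₄
    have h3 : (nL : ℝ) ^ 3 * Real.log nL ≤ κ * η / 4 * (d * n * v) := by
      refine le_of_mul_le_mul_right ?_ hnL0
      calc (nL : ℝ) ^ 3 * Real.log nL * nL = 1 * ((nL : ℝ) ^ 4 * Real.log nL) := by ring
        _ ≤ Real.log T ^ 2 * ((nL : ℝ) ^ 4 * Real.log nL) :=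
            mul_le_mul_of_nonneg_right (one_le_pow₀ hT) (by positivity)
        _ ≤ κ * η / 4 * (d * n * v) * v := by
            have : κ * η / 4 * (d * n * v) * v = κ * η / 4 * (d * n * v ^ 2) := by ring
            rw [this, ← mul_assoc]; exact hrate₄
        _ ≤ κ * η / 4 * (d * n * v) * nL := mul_le_mul_of_nonneg_left hvn (by positivity)
    have h5 : (nL : ℝ) ^ 2 * Real.log nL ≤ κ * η / 4 * (d * n * v) := by
      refine le_trans ?_ h3
      exact mul_le_mul_of_nonneg_right (pow_le_pow_right₀ hnL1 (by norm_num)) (by linarith)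
    have h6 : W / 4 = T / (nL : ℝ) ^ 2 * (κ * η / 4 * (d * n * v)) := by
      rw [hW]; field_simp
    have h7 : (T : ℝ) * Real.log nL = T / (nL : ℝ) ^ 2 * ((nL : ℝ) ^ 2 * Real.log nL) := by
      field_simp
    rw [h6, h7]
    exact mul_le_mul_of_nonneg_left h5 (by positivity)
  have h3 : (nL : ℝ) ^ T = Real.exp (T * Real.log nL) := by
    rw [Real.exp_nat_mul, Real.exp_log hnL0]
  have h4 : ((T : ℝ) + 1) ^ (nL * n) = Real.exp (nL * n * Real.log (T + 1)) := by
    rw [← Nat.cast_mul, Real.exp_nat_mul, Real.exp_log (by positivity)]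
  rw [hWe, h3, h4, ← Real.exp_add, ← Real.exp_add, Real.exp_le_exp]
  have h5 : (T : ℝ) ≤ T * Real.log nL := le_mul_of_one_le_right hT0.le hnL
  linarith

theorem theorem4
    -- a sequence of models with growing dimensions
    (nL n T : ℕ → ℕ)
    (hnL : Tendsto nL atTop atTop) (hn : Tendsto n atTop atTop) (hT : Tendsto T atTop atTop)
    (M : ∀ k, HubModel (nL k) (n k))
    -- the constants and sequences in the assumptions
    (cmin cmax smin smax τ c₀ : ℝ)
    (hcmin : 0 < cmin) (hsmin : 0 < smin) (hτ : 0 < τ) (hc₀ : 0 < c₀)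
    (d v : ℕ → ℝ) (hd : ∀ k, 0 < d k) (hv : ∀ k, 0 < v k)
    (s : ∀ k, Matrix (Fin (nL k)) (Fin (n k)) ℝ)
    (V : ∀ k, Fin (nL k) → Finset (Fin (n k)))
    -- the hub frequencies are balanced, with probability tending to one
    (H1 : Tendsto (fun k => (M k).law (T k) {ω | ∀ i,
        (T k : ℝ) * cmin / (nL k : ℝ) ≤ (labelCount (trueLabels ω) i : ℝ) ∧
        (labelCount (trueLabels ω) i : ℝ) ≤ (T k : ℝ) * cmax / (nL k : ℝ)}) atTop (𝓝 1))
    -- the off-diagonal entries of the matrix are of the order of the density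
    (H2 : ∀ k i j, j ≠ hubNode (M k).lt i →
        (M k).A i j = s k i j * d k ∧ smin ≤ s k i j ∧ s k i j ≤ smax)
    (H2' : Tendsto d atTop (𝓝 0))
    -- every hub has a set of followers that prefer it
    (H3 : ∀ k i, (∀ j ∈ V k i, nL k ≤ (j : ℕ)) ∧
        v k * (n k : ℝ) / (nL k : ℝ) ≤ ((V k i).card : ℝ) ∧
        ∀ i', i ≠ i' → ∀ j ∈ V k i, τ ≤ s k i j - s k i' j)
    -- hubs rarely join the groups of other hubs
    (H4 : ∀ k i i', i ≠ i' → (M k).A i (hubNode (M k).lt i') ≤ c₀ / (nL k : ℝ))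
    -- the rates
    (hrate₁ : Tendsto (fun k => (nL k : ℝ) * Real.log (n k) / (T k : ℝ)) atTop (𝓝 0))
    (hrate₂ : Tendsto (fun k => (nL k : ℝ) ^ 3 * Real.log (T k) / (d k * (T k : ℝ) * v k))
      atTop (𝓝 0))
    (hrate₃ : Tendsto (fun k => Real.log (d k) ^ 2 * (nL k : ℝ) ^ 4 * Real.log (nL k) /
      (d k * (n k : ℝ) * v k ^ 2)) atTop (𝓝 0))
    (hrate₄ : Tendsto (fun k => Real.log (T k) ^ 2 * (nL k : ℝ) ^ 4 * Real.log (nL k) /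
      (d k * (n k : ℝ) * v k ^ 2)) atTop (𝓝 0))
    -- the maximum profile likelihood estimator of the hub labels
    (zhat : ∀ k, (Fin (T k) → Fin (n k) → Bool) → (Fin (T k) → Fin (nL k)))
    (hzhat : ∀ k, IsMaxProfileLik (M k).lt (zhat k)) :
    ∀ ε : ℝ, 0 < ε →
      Tendsto (fun k => (M k).law (T k)
        {ω | ε ≤ maxError (M k).A (groups ω) (zhat k (groups ω))}) atTop (𝓝 0) := by
  intro ε hε
  obtain ⟨η, hη, hη1, hη2⟩ : ∃ η : ℝ, 0 < η ∧ η ≤ cmin / 4 ∧ η ≤ ε * cmin / 8 :=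
    ⟨min (cmin / 4) (ε * cmin / 8), by positivity, min_le_left _ _, min_le_right _ _⟩
  have hnLr : Tendsto (fun k => (nL k : ℝ)) atTop atTop := tendsto_natCast_atTop_atTop.comp hnL
  have hnr : Tendsto (fun k => (n k : ℝ)) atTop atTop := tendsto_natCast_atTop_atTop.comp hn
  have hTr : Tendsto (fun k => (T k : ℝ)) atTop atTop := tendsto_natCast_atTop_atTop.comp hT
  -- the range of the entries is not degenerate
  have hss : smin ≤ smax := by
    obtain ⟨k, hk⟩ := (hnL.eventually_ge_atTop 1).exists
    have h := H2 k ⟨0, hk⟩ ⟨nL k, (M k).lt⟩ (fun h => by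
      have := congrArg Fin.val h
      simp [hubNode] at this
      omega)
    exact h.2.1.trans h.2.2
  have hsmax : 0 < smax := hsmin.trans_le hss
  set κ : ℝ := τ ^ 2 / (32 * smax) with hκdef
  have hκ : 0 < κ := by positivity
  set H1set : ∀ k, Set (Fin (T k) → Fin (nL k) × (Fin (n k) → Bool)) := fun k => {ω | ∀ i,
        (T k : ℝ) * cmin / (nL k : ℝ) ≤ (labelCount (trueLabels ω) i : ℝ) ∧
        (labelCount (trueLabels ω) i : ℝ) ≤ (T k : ℝ) * cmax / (nL k : ℝ)} with hH1set
  have hbound : ∀ᶠ k in atTop, ((M k).law (T k)).real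
      {ω | ε ≤ maxError (M k).A (groups ω) (zhat k (groups ω))} ≤
      ((M k).law (T k)).real (H1set k)ᶜ + Real.exp (-(2 * Real.log (n k))) +
        Real.exp (-(T k : ℝ)) := by
    have e1 : ∀ᶠ k in atTop, smax * d k < ε := by
      have := H2'.const_mul smax
      rw [mul_zero] at this
      exact this.eventually_lt_const hε
    have e2 : ∀ᶠ k in atTop, 2 * smax * |cmax| * d k < η / 2 := by
      have := H2'.const_mul (2 * smax * |cmax|)
      rw [mul_zero] at this
      exact this.eventually_lt_const (half_pos hη)
    filter_upwards [e1, e2, (Real.tendsto_log_atTop.comp hnLr).eventually_ge_atTop 1,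
      (Real.tendsto_log_atTop.comp hTr).eventually_ge_atTop 1, hnL.eventually_ge_atTop 1,
      hT.eventually_ge_atTop 1,
      hrate₁.eventually_le_const (show (0 : ℝ) < η / 8 by positivity),
      hrate₂.eventually_le_const (show (0 : ℝ) < κ * η / 8 by positivity),
      hrate₄.eventually_le_const (show (0 : ℝ) < κ * η / 4 by positivity)]
      with k h1 h2 hlogL hlogT hL1 hT1 hr1 hr2 hr4
    have hL0 : (0 : ℝ) < nL k := by exact_mod_cast hL1
    have hT0 : (0 : ℝ) < T k := by exact_mod_cast hT1
    have hn0 : 0 < n k := hL1.trans (M k).lt.le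
    have hn0' : (0 : ℝ) < n k := by exact_mod_cast hn0
    have hvn : v k ≤ nL k := by
      have h := (H3 k ⟨0, hL1⟩).2.1.trans
        (Nat.cast_le.2 ((Finset.card_le_univ _).trans_eq (Fintype.card_fin _)))
      rw [div_le_iff₀ hL0, mul_comm] at h
      exact le_of_mul_le_mul_left h hn0'
    set u : ℝ := (T k : ℝ) / nL k with hu
    have hu0 : 0 < u := by positivity
    have hεc : ε * cmin * u > 0 := by positivity
    have hfin := law_real_maxError_le (M k) (hzhat k) (g := v k * n k / nL k * (κ * d k))
      (m := η * u) (x := η * u) (y := cmin * u) (y' := |cmax| * u) (α := smax * d k) (ε := ε)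
      (by have := hd k; have := hv k; positivity) (by positivity) ?_ ?_ (by positivity)
      (by nlinarith) h1 (by
        have a1 : η * u ≤ ε * cmin / 8 * u := mul_le_mul_of_nonneg_right hη2 hu0.le
        have a2 : ε * (η * u) ≤ ε * (cmin / 4 * u) :=
          mul_le_mul_of_nonneg_left (mul_le_mul_of_nonneg_right hη1 hu0.le) hε.le
        linarith) hε
    · refine hfin.trans (add_le_add (add_le_add (measureReal_mono ?_) ?_) ?_)
      · refine Set.compl_subset_compl.2 fun ω hω i => ?_
        obtain ⟨b1, b2⟩ := hω i
        have hc : (T k : ℝ) * cmax / nL k ≤ |cmax| * u := by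
          rw [mul_comm, mul_div_assoc]
          exact mul_le_mul_of_nonneg_right (le_abs_self _) hu0.le
        refine ⟨?_, b2.trans hc⟩
        rwa [mul_comm, mul_div_assoc] at b1
      · refine entries_bound hL0 (by exact_mod_cast (M k).lt.le) hr1 hT0 ?_
        have := mul_le_mul_of_nonneg_right h2.le hu0.le
        linarith
      · exact assignments_bound (hd k) (hv k) hκ hη hlogL hn0 hlogT hvn hr2 hr4
    · intro B a b i hab
      have hV : ∀ a', ∀ j ∈ V k a, j ≠ hubNode (M k).lt a' := by
        intro a' j hj h
        have h3 := (H3 k a).1 j hj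
        rw [h] at h3
        exact absurd a'.2 (not_lt.2 h3)
      have hsep := hellingerLoss_add_ge (A := (M k).A) (B := B) (s := s k) (a := a) (b := b) i
        (V := V k a) (hd k) hτ (fun j hj => ⟨(H2 k a j (hV a j hj)).1, (H2 k a j (hV a j hj)).2.2⟩)
        (fun j hj => ⟨(H2 k b j (hV b j hj)).1,
          hsmin.le.trans (H2 k b j (hV b j hj)).2.1⟩) ((H3 k a).2.2 b hab)
      refine le_trans ?_ hsep
      have hdk := hd k
      calc 2 * (v k * n k / nL k * (κ * d k))
          = v k * n k / nL k * (τ ^ 2 * d k / (16 * smax)) := by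
            rw [hκdef]; field_simp; ring
        _ ≤ _ := mul_le_mul_of_nonneg_right (H3 k a).2.1 (by positivity)
    · intro i j hj
      rw [(H2 k i j hj).1]
      exact mul_le_mul_of_nonneg_right (H2 k i j hj).2.2 (hd k).le
  have hH1 : Tendsto (fun k => ((M k).law (T k)).real (H1set k)ᶜ) atTop (𝓝 0) := by
    have h := (ENNReal.tendsto_toReal ENNReal.one_ne_top).comp H1
    have h' : Tendsto (fun k => 1 - ((M k).law (T k)).real (H1set k)) atTop (𝓝 (1 - 1)) :=
      tendsto_const_nhds.sub h
    rw [sub_self] at h'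
    refine h'.congr fun k => ?_
    rw [measureReal_compl (Set.toFinite _).measurableSet, probReal_univ]
  have hlim : Tendsto (fun k => ((M k).law (T k)).real (H1set k)ᶜ +
      Real.exp (-(2 * Real.log (n k))) + Real.exp (-(T k : ℝ))) atTop (𝓝 0) := by
    have h2 : Tendsto (fun k => Real.exp (-(2 * Real.log (n k)))) atTop (𝓝 0) :=
      Real.tendsto_exp_neg_atTop_nhds_zero.comp
        ((Real.tendsto_log_atTop.comp hnr).const_mul_atTop two_pos)
    have h3 : Tendsto (fun k => Real.exp (-(T k : ℝ))) atTop (𝓝 0) :=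
      Real.tendsto_exp_neg_atTop_nhds_zero.comp hTr
    simpa using (hH1.add h2).add h3
  have hreal := squeeze_zero' (Eventually.of_forall fun k => measureReal_nonneg) hbound hlim
  exact (ENNReal.tendsto_toReal_zero_iff fun k => measure_ne_top _ _).1 hreal
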